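/- Let $n\ge 0$ be an integer, let $\theta_1,\dots,\theta_n\in\mathbb R$ and $z_j=e^{-i\theta_j}$. Let $T$ be the translation on $L^2(\mathbb R)^n$ given by $T(\varphi_1,\dots,\varphi_n)=(z_1\varphi_1(\cdot-1),\dots,z_n\varphi_n(\cdot-1))$. With $\hat f(\xi)=\int_{\mathbb R}f(x)e^{-i\xi x}\,dx$ (extended to $L^2(\mathbb R)$ by Plancherel's theorem), the fiber of $\varphi=(\varphi_1,\dots,\varphi_n)\in L^2(\mathbb R)^n$ at $\xi$ is $$\mathcal T_{per}\varphi(\xi)=\Big(\big(\hat\varphi_j(\xi-\theta_j+2k\pi)\big)_{k\in\mathbb Z}\Big)_{j=1}^n\in \ell^2(\mathbb Z)^n\qquad(\text{a.e. }\xi\in\mathbb R).$$ Inner products are linear in the first variable. Let $V$ be a shift-invariant subspace of $L^2(\mathbb R)^n$, that is, a closed subspace with $T^kV\subseteq V$ for all $k\in\mathbb Z$. Let $J_{per}$ be its periodic range function: a map from $\mathbb R$ to the closed subspaces of $\ell^2(\mathbb Z)^n$ such that $\xi\mapsto\langle J_{per}(\xi)a,b\rangle$ is measurable for all $a,b\in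 \ell^2(\mathbb Z)^n$ (where $J_{per}(\xi)$ also denotes the orthogonal projection onto the subspace $J_{per}(\xi)$), $J_{per}(\xi+2k\pi)=\lambda(k)^*(J_{per}(\xi))$ for all $k\in\mathbb Z$, $\xi\in\mathbb R$, with $(\lambda(k)\alpha)(l,j)=\alpha(l-k,j)$, and $$V=\{f\in L^2(\mathbb R)^n : \mathcal T_{per}f(\xi)\in J_{per}(\xi)\text{ for a.e. }\xi\in\mathbb R\}.$$ Let $\Phi\subseteq V$ be a normalized tight frame (NTF) generator for $V$, that is, $\sum_{k\in\mathbb Z,\ \varphi\in\Phi}|\langle f,T^k\varphi\rangle|^2=\|f\|^2$ for all $f\in V$ (the family is indexed by $\mathbb Z\times\Phi$). For a bounded operator $S$ on $\ell^2(\mathbb Z)^n$ that is positive or of trace class (i.e. $\operatorname{Trace}|S|<\infty$), let $\tau_{V,S}(\xi)=\operatorname{Trace}(S\,J_{per}(\xi))$ be the local trace; it lies in $[0,\infty]$ for positive $S$, where it is understood as $\operatorname{Trace}(J_{per}(\xi)\,S\,J_{per}(\xi))$, and in $\mathbb C$ for trace-class $S$. For $f\in \ell^2(\mathbb Z)^n$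 let $\tau_{V,f}=\tau_{V,P_f}$, where $P_fv=\langle v,f\rangle f$. Then: 1. For every positive operator $S$ on $\ell^2(\mathbb Z)^n$, $$\tau_{V,S}(\xi)=\sum_{\varphi\in\Phi}\langle S\,\mathcal T_{per}\varphi(\xi),\mathcal T_{per}\varphi(\xi)\rangle\quad\text{for a.e. }\xi\in\mathbb R,$$ as an equality in $[0,\infty]$. 2. For every trace-class operator $S$ on $\ell^2(\mathbb Z)^n$ and a.e. $\xi\in\mathbb R$, the operator $S\,J_{per}(\xi)$ is of trace class, and the same formula holds, with an absolutely convergent sum in $\mathbb C$. 3. For every $f\in \ell^2(\mathbb Z)^n$, $$\tau_{V,f}(\xi)=\sum_{\varphi\in\Phi}|\langle f,\mathcal T_{per}\varphi(\xi)\rangle|^2\quad\text{for a.e. }\xi\in\mathbb R,$$ whether $P_f$ is regarded as a positive or as a trace-class operator. 4. Consequently the sums in 1, 2 and 3 do not depend on the choice of the generator: for any other NTF generator $\Psi$ of $V$, replacing $\Phi$ by $\Psi$ changes each of them only on a set of $\xi$ of measure zero. -/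

import Mathlib

open MeasureTheory Filter
open scoped ENNReal FourierTransform

noncomputable section

namespace LocalTrace

/-- The Hilbert space `L²(ℝ)ⁿ`. -/
abbrev L2n (n : ℕ) : Type := PiLp 2 (fun _ : Fin n => Lp ℂ 2 (volume : Measure ℝ))

/-- The Hilbert space `ℓ²(ℤ)`. -/
abbrev L2Z : Type := lp (fun _ : ℤ => ℂ) 2

/-- The Hilbert space `ℓ²(ℤ)ⁿ`. -/
abbrev L2Zn (n : ℕ) : Type := PiLp 2 (fun _ : Fin n => L2Z)

/-! ### Translations, fibers -/

/-- The power `T ^ k` of the translation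
`T (φ₁, …, φₙ) = (z₁ φ₁(· - 1), …, zₙ φₙ(· - 1))`, where `z_j = exp (-i θ_j)`; that is, the `j`-th
component of `T ^ k φ` is `x ↦ exp (-i k θ_j) φ_j (x - k)`. -/
def shift {n : ℕ} (θ : Fin n → ℝ) (k : ℤ) (φ : L2n n) : L2n n :=
  WithLp.toLp 2 fun j =>
    Complex.exp (-(Complex.I * (k : ℂ) * (θ j : ℂ))) •
      Lp.compMeasurePreserving (fun x : ℝ => x - (k : ℝ))
        (measurePreserving_sub_right volume (k : ℝ)) (φ j)

/-- (A representative of) the Fourier transform `f̂(ξ) = ∫ f(x) e^{-i ξ x} dx` of `f ∈ L²(ℝ)`,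
expressed through the Plancherel transform `𝓕 f (w) = ∫ f(x) e^{-2 π i w x} dx`. -/
def hat (f : Lp ℂ 2 (volume : Measure ℝ)) (ξ : ℝ) : ℂ :=
  (𝓕 f : Lp ℂ 2 (volume : Measure ℝ)) (ξ / (2 * Real.pi))

open Classical in
/-- The sequence `(f̂(ξ + 2 k π))_{k ∈ ℤ}` as an element of `ℓ²(ℤ)`. It is square summable for
almost every `ξ`; on the exceptional null set the value is `0`. -/
def fiber₁ (f : Lp ℂ 2 (volume : Measure ℝ)) (ξ : ℝ) : L2Z :=
  if h : Memℓp (fun k : ℤ => hat f (ξ + 2 * (k : ℝ) * Real.pi)) 2 then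
    ⟨fun k : ℤ => hat f (ξ + 2 * (k : ℝ) * Real.pi), h⟩
  else 0

/-- The fiber `𝒯_per φ (ξ)`, with components `(φ̂_j(ξ - θ_j + 2 k π))_{k ∈ ℤ}`, `1 ≤ j ≤ n`. -/
def fiber {n : ℕ} (θ : Fin n → ℝ) (φ : L2n n) (ξ : ℝ) : L2Zn n :=
  WithLp.toLp 2 fun j => fiber₁ (φ j) (ξ - θ j)

/-! ### Shift invariant subspaces and normalized tight frame generators -/

/-- A closed subspace `V` of `L²(ℝ)ⁿ` is shift invariant if `T ^ k V ⊆ V` for all `k ∈ ℤ`. -/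
def IsShiftInvariant {n : ℕ} (θ : Fin n → ℝ) (V : ClosedSubmodule ℂ (L2n n)) : Prop :=
  ∀ k : ℤ, ∀ φ ∈ V, shift θ k φ ∈ V

/-- The family `e` is a normalized tight frame for the closed subspace `V`. -/
def IsNTF {H ι : Type*} [NormedAddCommGroup H] [InnerProductSpace ℂ H]
    (V : ClosedSubmodule ℂ H) (e : ι → H) : Prop :=
  (∀ i, e i ∈ V) ∧ ∀ f ∈ V, HasSum (fun i => ‖inner ℂ f (e i)‖ ^ 2) (‖f‖ ^ 2)

/-- `Φ` is a normalized tight frame generator for `V`: `Φ ⊆ V` and the family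
`(T ^ k φ)`, indexed by `(k, φ) ∈ ℤ × Φ`, is a normalized tight frame for `V`. -/
def IsNTFGenerator {n : ℕ} (θ : Fin n → ℝ) (V : ClosedSubmodule ℂ (L2n n))
    (Φ : Set (L2n n)) : Prop :=
  (∀ φ ∈ Φ, φ ∈ V) ∧ IsNTF V (fun p : ℤ × Φ => shift θ p.1 (p.2 : L2n n))

/-! ### Range functions -/

theorem memℓp_shift (s : ℤ) (v : L2Z) : Memℓp (fun k : ℤ => v (k - s)) 2 := by
  have h := (memℓp_gen_iff (by norm_num : 0 < (2 : ℝ≥0∞).toReal)).1 (lp.memℓp v)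
  exact memℓp_gen (((Equiv.subRight s).summable_iff).2 h)

/-- The bilateral shift `(k ↦ v k) ↦ (k ↦ v (k - s))` on `ℓ²(ℤ)`. -/
def lam₁ (s : ℤ) : L2Z ≃ₗᵢ[ℂ] L2Z where
  toFun v := ⟨fun k => v (k - s), memℓp_shift s v⟩
  invFun v := ⟨fun k => v (k - (-s)), memℓp_shift (-s) v⟩
  map_add' v w := by ext k; rfl
  map_smul' c v := by ext k; rfl
  left_inv v := by
    ext k
    change (v : ℤ → ℂ) (k - (-s) - s) = (v : ℤ → ℂ) k
    exact congrArg (v : ℤ → ℂ) (by omega)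
  right_inv v := by
    ext k
    change (v : ℤ → ℂ) (k - s - (-s)) = (v : ℤ → ℂ) k
    exact congrArg (v : ℤ → ℂ) (by omega)
  norm_map' v := by
    have h2 : 0 < (2 : ℝ≥0∞).toReal := by norm_num
    rw [lp.norm_eq_tsum_rpow h2, lp.norm_eq_tsum_rpow h2]
    congr 1
    exact (Equiv.subRight s).tsum_eq (fun k => ‖v k‖ ^ (2 : ℝ≥0∞).toReal)

/-- The unitary shift `(λ(s) α)(k, j) = α(k - s, j)` on `ℓ²(ℤ)ⁿ`. -/
def lam {n : ℕ} (s : ℤ) : L2Zn n ≃ₗᵢ[ℂ] L2Zn n :=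
  LinearIsometryEquiv.piLpCongrRight 2 (fun _ : Fin n => lam₁ s)

/-- The orthogonal projection onto a closed subspace of a Hilbert space. -/
def proj {H : Type*} [NormedAddCommGroup H] [InnerProductSpace ℂ H] [CompleteSpace H]
    (K : ClosedSubmodule ℂ H) : H →L[ℂ] H :=
  K.toSubmodule.starProjection

/-- A periodic range function: a (Lebesgue) weakly measurable map `J` from `ℝ` to the closed
subspaces of `ℓ²(ℤ)ⁿ` with `J(ξ + 2 k π) = λ(k)* J(ξ)`. Here `λ(k)* = λ(k)⁻¹`. -/
structure IsPeriodicRangeFunction {n : ℕ} (J : ℝ → ClosedSubmodule ℂ (L2Zn n)) : Prop where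
  measurable : ∀ a b : L2Zn n, AEMeasurable (fun ξ => inner ℂ (proj (J ξ) a) b) volume
  periodic : ∀ (k : ℤ) (ξ : ℝ),
    (J (ξ + 2 * (k : ℝ) * Real.pi) : Set (L2Zn n)) = (lam k).symm '' (J ξ : Set (L2Zn n))

/-- `J` is the periodic range function of `V`:
`V = {f ∈ L²(ℝ)ⁿ | 𝒯_per f (ξ) ∈ J ξ for a.e. ξ}`. -/
structure IsRangeFunctionOf {n : ℕ} (θ : Fin n → ℝ) (V : ClosedSubmodule ℂ (L2n n))
    (J : ℝ → ClosedSubmodule ℂ (L2Zn n)) : Prop extends IsPeriodicRangeFunction J where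
  mem_iff : ∀ f : L2n n, f ∈ V ↔ ∀ᵐ ξ : ℝ, fiber θ f ξ ∈ J ξ

/-! ### Traces -/

section Trace

variable {H : Type*} [NormedAddCommGroup H] [InnerProductSpace ℂ H] [CompleteSpace H]

variable (H) in
/-- A fixed orthonormal basis of the Hilbert space `H`, as a set of vectors. -/
def onb : Set H := (exists_hilbertBasis ℂ H).choose

/-- The trace in `[0, ∞]` of a positive operator. -/
def posTrace (T : H →L[ℂ] H) : ℝ≥0∞ :=
  ∑' e : onb H, ENNReal.ofReal (RCLike.re (inner ℂ (e : H) (T e)))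

/-- `T` is of trace class if its absolute value `|T| = (T* T)^{1/2}` has finite trace. -/
def IsTraceClass (T : H →L[ℂ] H) : Prop := posTrace (CFC.abs T) < ∞

/-- The trace of a trace-class operator. -/
def trace (T : H →L[ℂ] H) : ℂ := ∑' e : onb H, inner ℂ (e : H) (T e)

/-- The rank-one operator `P_f v = ⟨v, f⟩ f` (inner product linear in the first variable; in
Mathlib's convention, `P_f v = inner ℂ f v • f`). -/
def rankOneOp (f : H) : H →L[ℂ] H := InnerProductSpace.rankOne ℂ f f

end Trace

/-- The local trace `Trace (T J(ξ)) ∈ [0, ∞]` for a positive operator `T`; as `T J(ξ)` need not be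
positive, its trace is understood as that of the positive operator `J(ξ) T J(ξ)`. -/
def localTracePos {n : ℕ} (J : ℝ → ClosedSubmodule ℂ (L2Zn n)) (T : L2Zn n →L[ℂ] L2Zn n)
    (ξ : ℝ) : ℝ≥0∞ :=
  posTrace (proj (J ξ) ∘L T ∘L proj (J ξ))

/-- The local trace `Trace (T J(ξ)) ∈ ℂ` for a trace-class operator `T`. -/
def localTrace {n : ℕ} (J : ℝ → ClosedSubmodule ℂ (L2Zn n)) (T : L2Zn n →L[ℂ] L2Zn n)
    (ξ : ℝ) : ℂ :=
  trace (T ∘L proj (J ξ))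

end LocalTrace

end

open LocalTrace

/-!
For almost every `ξ` the fibers `𝒯_per φ (ξ)`, `φ ∈ Φ`, form a normalized tight frame of `J ξ`, and
the trace formulas hold for normalized tight frames of closed subspaces in any Hilbert space.

Indeed, `𝒯_per` turns `T ^ k` into multiplication by `e^{-ikξ}`, so the numbers `⟨f, T ^ k φ⟩` are
the Fourier coefficients of the `2π`-periodic function `ξ ↦ ⟨𝒯_per f (ξ), 𝒯_per φ (ξ)⟩`, and
Parseval's identity for Fourier series turns the frame identity for `f ∈ V` into an identity of
integrals over `(0, 2π]`. Applied to the `f` with fibers `1_E(ξ) J(ξ) a`, for all measurable `E`, it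
gives `∑_φ |⟨𝒯_per φ (ξ), a⟩|² = ‖J(ξ) a‖²` for almost every `ξ`; a countable dense set of vectors
`a` suffices.

The analysis operator `Θ` of a normalized tight frame `(fᵢ)` of `K` satisfies `Θ* Θ = proj K` and
`Θ* eᵢ = fᵢ`. Hence `Trace (S proj K) = Trace (Θ S Θ*) = ∑ ⟨S fᵢ, fᵢ⟩` by cyclicity of the trace,
which reduces to `Trace (A* B) = Trace (B A*)` for Hilbert–Schmidt operators `A` and `B`.
-/

noncomputable section

namespace LocalTrace

open ContinuousLinearMap
open scoped InnerProductSpace InnerProduct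

section NormSums

variable {ι E F : Type*} [NormedAddCommGroup E] [NormedAddCommGroup F]

theorem hasSum_norm_sq_iff_tsum_enorm_sq {g : ι → E} {x : F} :
    HasSum (fun i => ‖g i‖ ^ 2) (‖x‖ ^ 2) ↔ ∑' i, ‖g i‖ₑ ^ 2 = ‖x‖ₑ ^ 2 := by
  rw [← ENNReal.summable.hasSum_iff]
  simp only [← coe_nnnorm, enorm_eq_nnnorm, ← NNReal.coe_pow, ← ENNReal.coe_pow]
  exact NNReal.hasSum_coe.trans ENNReal.hasSum_coe.symm

theorem summable_norm_sq_iff_tsum_enorm_sq {g : ι → E} :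
    Summable (fun i => ‖g i‖ ^ 2) ↔ ∑' i, ‖g i‖ₑ ^ 2 ≠ ∞ := by
  simp only [← coe_nnnorm, enorm_eq_nnnorm, ← NNReal.coe_pow, ← ENNReal.coe_pow]
  exact NNReal.summable_coe.trans ENNReal.tsum_coe_ne_top_iff_summable.symm

theorem summable_mul_of_tsum_enorm_sq {f g : ι → ℂ}
    (hf : ∑' i, ‖f i‖ₑ ^ 2 ≠ ∞) (hg : ∑' i, ‖g i‖ₑ ^ 2 ≠ ∞) : Summable (fun i => f i * g i) := by
  refine Summable.of_norm_bounded ((summable_norm_sq_iff_tsum_enorm_sq.2 hf).add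
    (summable_norm_sq_iff_tsum_enorm_sq.2 hg)) fun i => ?_
  rw [norm_mul]
  nlinarith [sq_nonneg (‖f i‖ - ‖g i‖), sq_nonneg ‖f i‖, sq_nonneg ‖g i‖]

theorem ofReal_norm_sq (x : E) : ENNReal.ofReal (‖x‖ ^ 2) = ‖x‖ₑ ^ 2 := by
  rw [ENNReal.ofReal_pow (norm_nonneg x), ofReal_norm]

end NormSums

section Hilbert

variable {H H₁ H₂ H₃ : Type*}
  [NormedAddCommGroup H] [InnerProductSpace ℂ H]
  [NormedAddCommGroup H₁] [InnerProductSpace ℂ H₁]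
  [NormedAddCommGroup H₂] [InnerProductSpace ℂ H₂]
  [NormedAddCommGroup H₃] [InnerProductSpace ℂ H₃]
  {κ κ₁ κ₂ : Type*}

theorem enorm_inner_symm (x y : H) : ‖⟪x, y⟫_ℂ‖ₑ = ‖⟪y, x⟫_ℂ‖ₑ := by
  rw [← ofReal_norm, ← ofReal_norm, norm_inner_symm]

theorem tsum_enorm_inner_sq (b : HilbertBasis κ ℂ H) (x : H) :
    ∑' e, ‖⟪b e, x⟫_ℂ‖ₑ ^ 2 = ‖x‖ₑ ^ 2 := by
  refine hasSum_norm_sq_iff_tsum_enorm_sq.1 ?_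
  have hnorm : (⟪x, x⟫_ℂ).re = ‖x‖ ^ 2 := inner_self_eq_norm_sq (𝕜 := ℂ) x
  have hparseval := Complex.hasSum_re (b.hasSum_inner_mul_inner x x)
  rw [hnorm] at hparseval
  refine hparseval.congr_fun fun e => ?_
  rw [← inner_conj_symm x (b e), Complex.conj_mul']
  norm_cast

variable [CompleteSpace H] [CompleteSpace H₁]

variable (H) in
/-- The Hilbert basis whose vectors form `onb H`. -/
def onbBasis : HilbertBasis (onb H) ℂ H := (exists_hilbertBasis ℂ H).choose_spec.choose

theorem onbBasis_apply (e : onb H) : onbBasis H e = e :=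
  congrFun (exists_hilbertBasis ℂ H).choose_spec.choose_spec e

/-- The square, in `[0, ∞]`, of the Hilbert–Schmidt norm of a bounded operator; by
`hsNormSq_eq_tsum` it can be computed in any orthonormal basis. -/
def hsNormSq (A : H₁ →L[ℂ] H₂) : ℝ≥0∞ := ∑' e : onb H₁, ‖A e‖ₑ ^ 2

/-- A Hilbert–Schmidt operator between complex Hilbert spaces. -/
def IsHilbertSchmidt (A : H₁ →L[ℂ] H₂) : Prop := hsNormSq A < ∞

theorem hsNormSq_congr_norm {A : H₁ →L[ℂ] H₂} {B : H₁ →L[ℂ] H₃} (h : ∀ x, ‖A x‖ = ‖B x‖) :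
    hsNormSq A = hsNormSq B := by
  simp only [hsNormSq, ← ofReal_norm, h]

theorem hsNormSq_comp_le (U : H₂ →L[ℂ] H₃) (A : H₁ →L[ℂ] H₂) :
    hsNormSq (U ∘L A) ≤ ‖U‖ₑ ^ 2 * hsNormSq A := by
  simp only [hsNormSq, ← ENNReal.tsum_mul_left, ← mul_pow]
  gcongr
  exact U.le_opENorm _

theorem IsHilbertSchmidt.left_comp {A : H₁ →L[ℂ] H₂} (hA : IsHilbertSchmidt A)
    (U : H₂ →L[ℂ] H₃) : IsHilbertSchmidt (U ∘L A) :=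
  (hsNormSq_comp_le U A).trans_lt (ENNReal.mul_lt_top (by simp) hA)

variable [CompleteSpace H₂]

theorem tsum_enorm_adjoint_sq (b₁ : HilbertBasis κ₁ ℂ H₁) (b₂ : HilbertBasis κ₂ ℂ H₂)
    (A : H₁ →L[ℂ] H₂) : ∑' j, ‖(A†) (b₂ j)‖ₑ ^ 2 = ∑' i, ‖A (b₁ i)‖ₑ ^ 2 :=
  calc ∑' j, ‖(A†) (b₂ j)‖ₑ ^ 2
      = ∑' j, ∑' i, ‖⟪b₁ i, (A†) (b₂ j)⟫_ℂ‖ₑ ^ 2 := by simp only [tsum_enorm_inner_sq]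
    _ = ∑' i, ∑' j, ‖⟪b₁ i, (A†) (b₂ j)⟫_ℂ‖ₑ ^ 2 := ENNReal.tsum_comm
    _ = ∑' i, ∑' j, ‖⟪b₂ j, A (b₁ i)⟫_ℂ‖ₑ ^ 2 := by
        simp only [adjoint_inner_right, fun i j => enorm_inner_symm (A (b₁ i)) (b₂ j)]
    _ = ∑' i, ‖A (b₁ i)‖ₑ ^ 2 := by simp only [tsum_enorm_inner_sq]

theorem hsNormSq_adjoint (A : H₁ →L[ℂ] H₂) : hsNormSq (A†) = hsNormSq A := by
  simp only [hsNormSq, ← onbBasis_apply]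
  exact tsum_enorm_adjoint_sq (onbBasis H₁) (onbBasis H₂) A

theorem hsNormSq_eq_tsum (A : H₁ →L[ℂ] H₂) (b : HilbertBasis κ ℂ H₁) :
    hsNormSq A = ∑' i, ‖A (b i)‖ₑ ^ 2 := by
  rw [← hsNormSq_adjoint, ← tsum_enorm_adjoint_sq b (onbBasis H₂)]
  simp only [hsNormSq, onbBasis_apply]

theorem IsHilbertSchmidt.adjoint {A : H₁ →L[ℂ] H₂} (hA : IsHilbertSchmidt A) :
    IsHilbertSchmidt (A†) :=
  (hsNormSq_adjoint A).trans_lt hA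

theorem IsHilbertSchmidt.comp_right [CompleteSpace H₃] {A : H₂ →L[ℂ] H₃}
    (hA : IsHilbertSchmidt A) (U : H₁ →L[ℂ] H₂) : IsHilbertSchmidt (A ∘L U) := by
  simpa only [adjoint_comp, adjoint_adjoint] using (hA.adjoint.left_comp (U†)).adjoint

theorem hasSum_inner_apply_apply {A B : H₁ →L[ℂ] H₂} (hA : IsHilbertSchmidt A)
    (hB : IsHilbertSchmidt B) (b₁ : HilbertBasis κ₁ ℂ H₁) (b₂ : HilbertBasis κ₂ ℂ H₂) :
    HasSum (fun i => ⟪A (b₁ i), B (b₁ i)⟫_ℂ) (∑' j, ⟪(B†) (b₂ j), (A†) (b₂ j)⟫_ℂ) := by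
  have hdouble : ∀ {C : H₁ →L[ℂ] H₂}, IsHilbertSchmidt C →
      ∑' p : κ₂ × κ₁, ‖⟪b₂ p.1, C (b₁ p.2)⟫_ℂ‖ₑ ^ 2 ≠ ∞ := fun {C} hC => by
    rw [ENNReal.tsum_prod', ENNReal.tsum_comm]
    simpa only [tsum_enorm_inner_sq, ← hsNormSq_eq_tsum] using hC.ne
  have hsum : Summable fun p : κ₂ × κ₁ => ⟪A (b₁ p.2), b₂ p.1⟫_ℂ * ⟪b₂ p.1, B (b₁ p.2)⟫_ℂ := by
    refine summable_mul_of_tsum_enorm_sq ?_ (hdouble hB)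
    simpa only [enorm_inner_symm (A _)] using hdouble hA
  have hrow : ∀ j, HasSum (fun i => ⟪A (b₁ i), b₂ j⟫_ℂ * ⟪b₂ j, B (b₁ i)⟫_ℂ)
      ⟪(B†) (b₂ j), (A†) (b₂ j)⟫_ℂ := fun j => by
    simpa only [adjoint_inner_left, adjoint_inner_right, mul_comm] using
      b₁.hasSum_inner_mul_inner ((B†) (b₂ j)) ((A†) (b₂ j))
  have hcolumn : ∀ i, HasSum (fun j => ⟪A (b₁ i), b₂ j⟫_ℂ * ⟪b₂ j, B (b₁ i)⟫_ℂ)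
      ⟪A (b₁ i), B (b₁ i)⟫_ℂ := fun i => b₂.hasSum_inner_mul_inner _ _
  rw [(hsum.hasSum.prod_fiberwise hrow).tsum_eq]
  exact ((Equiv.prodComm κ₁ κ₂).hasSum_iff.2 hsum.hasSum).prod_fiberwise hcolumn

theorem trace_adjoint_comp (A B : H₁ →L[ℂ] H₂) :
    trace (A† ∘L B) = ∑' e, ⟪A (onbBasis H₁ e), B (onbBasis H₁ e)⟫_ℂ := by
  simp only [trace, onbBasis_apply, comp_apply, adjoint_inner_right]

theorem trace_adjoint_comp_comm {A B : H₁ →L[ℂ] H₂} (hA : IsHilbertSchmidt A)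
    (hB : IsHilbertSchmidt B) : trace (A† ∘L B) = trace (B ∘L A†) := by
  rw [trace_adjoint_comp, (hasSum_inner_apply_apply hA hB _ (onbBasis H₂)).tsum_eq,
    ← trace_adjoint_comp, adjoint_adjoint]

theorem hasSum_trace_adjoint_comp {A B : H₁ →L[ℂ] H₂} (hA : IsHilbertSchmidt A)
    (hB : IsHilbertSchmidt B) (b : HilbertBasis κ ℂ H₁) :
    HasSum (fun i => ⟪A (b i), B (b i)⟫_ℂ) (trace (A† ∘L B)) := by
  rw [trace_adjoint_comp_comm hA hB, ← adjoint_adjoint B, trace_adjoint_comp, adjoint_adjoint]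
  exact hasSum_inner_apply_apply hA hB b (onbBasis H₂)

theorem posTrace_adjoint_comp_self (A : H₁ →L[ℂ] H₂) : posTrace (A† ∘L A) = hsNormSq A := by
  simp only [posTrace, hsNormSq, comp_apply, adjoint_inner_right, inner_self_eq_norm_sq,
    ofReal_norm_sq]

end Hilbert

section Traces

variable {H H₁ H₂ H₃ : Type*}
  [NormedAddCommGroup H] [InnerProductSpace ℂ H]
  [NormedAddCommGroup H₁] [InnerProductSpace ℂ H₁]
  [NormedAddCommGroup H₂] [InnerProductSpace ℂ H₂] [CompleteSpace H₂]
  [NormedAddCommGroup H₃] [InnerProductSpace ℂ H₃] [CompleteSpace H₃]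

theorem isPositive_rankOneOp (f : H) : (rankOneOp f).IsPositive :=
  InnerProductSpace.isPositive_rankOne_self f

theorem inner_rankOneOp (f x : H) : ⟪x, rankOneOp f x⟫_ℂ = (‖⟪x, f⟫_ℂ‖ ^ 2 : ℝ) := by
  rw [rankOneOp, InnerProductSpace.rankOne_apply, inner_smul_right, ← inner_conj_symm f x,
    Complex.conj_mul', Complex.ofReal_pow]

/-- A weak form of Douglas' factorization lemma. -/
theorem exists_comp_eq_of_norm_apply_le {A : H₁ →L[ℂ] H₃} {B : H₁ →L[ℂ] H₂} {C : ℝ}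
    (h : ∀ x, ‖A x‖ ≤ C * ‖B x‖) : ∃ U : H₂ →L[ℂ] H₃, U ∘L B = A := by
  let R := LinearMap.range (B : H₁ →ₗ[ℂ] H₂)
  have hBR (x : H₁) : B x ∈ R.topologicalClosure := R.le_topologicalClosure ⟨x, rfl⟩
  have : CompleteSpace R.topologicalClosure := R.isClosed_topologicalClosure.completeSpace_coe
  let B' : H₁ →ₗ[ℂ] R.topologicalClosure := (B : H₁ →ₗ[ℂ] H₂).codRestrict _ hBR
  have hdense : DenseRange B' := fun y => by
    have hrange : Subtype.val '' Set.range B' = (R : Set H₂) := by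
      rw [← Set.range_comp]; rfl
    rw [closure_subtype, hrange]
    exact y.2
  let U := (A : H₁ →ₗ[ℂ] H₃).extendOfNorm B'
  refine ⟨U ∘L R.topologicalClosure.orthogonalProjectionOnto, ext fun x => ?_⟩
  have hproj : R.topologicalClosure.orthogonalProjectionOnto (B x) = B' x :=
    Submodule.orthogonalProjectionOnto_mem_subspace_eq_self ⟨B x, hBR x⟩
  rw [comp_apply, comp_apply, hproj]
  exact LinearMap.extendOfNorm_eq hdense ⟨C, h⟩ x

variable [CompleteSpace H] [CompleteSpace H₁]

theorem adjoint_comp_self_eq_iff {A : H₁ →L[ℂ] H₂} {B : H₁ →L[ℂ] H₃} :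
    A† ∘L A = B† ∘L B ↔ ∀ x, ‖A x‖ = ‖B x‖ := by
  refine ⟨fun h x => ?_, fun h => coe_inj.1 ((ext_inner_map _ _).1 fun x => ?_)⟩
  · rw [← sq_eq_sq₀ (norm_nonneg _) (norm_nonneg _), apply_norm_sq_eq_inner_adjoint_left, h,
      ← apply_norm_sq_eq_inner_adjoint_left]
  · change ⟪(A†) (A x), x⟫_ℂ = ⟪(B†) (B x), x⟫_ℂ
    rw [adjoint_inner_left, adjoint_inner_left, inner_self_eq_norm_sq_to_K,
      inner_self_eq_norm_sq_to_K, h]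

theorem adjoint_eq_self_of_nonneg {T : H →L[ℂ] H} (hT : 0 ≤ T) : T† = T :=
  (IsSelfAdjoint.of_nonneg hT).adjoint_eq

theorem norm_abs_apply (T : H →L[ℂ] H) (x : H) : ‖CFC.abs T x‖ = ‖T x‖ := by
  refine adjoint_comp_self_eq_iff.1 ?_ x
  rw [adjoint_eq_self_of_nonneg (CFC.abs_nonneg T)]
  exact CFC.abs_mul_abs T

theorem adjoint_sqrt_comp_sqrt {T : H →L[ℂ] H} (hT : 0 ≤ T) :
    (CFC.sqrt T)† ∘L CFC.sqrt T = T := by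
  rw [adjoint_eq_self_of_nonneg (CFC.sqrt_nonneg T)]
  exact CFC.sqrt_mul_sqrt_self T hT

theorem posTrace_eq_hsNormSq_sqrt {T : H →L[ℂ] H} (hT : 0 ≤ T) :
    posTrace T = hsNormSq (CFC.sqrt T) := by
  rw [← posTrace_adjoint_comp_self, adjoint_sqrt_comp_sqrt hT]

theorem ofReal_re_inner_eq_enorm_sqrt_sq {T : H →L[ℂ] H} (hT : 0 ≤ T) (x : H) :
    ENNReal.ofReal (RCLike.re ⟪x, T x⟫_ℂ) = ‖CFC.sqrt T x‖ₑ ^ 2 := by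
  rw [← ofReal_norm_sq, apply_norm_sq_eq_inner_adjoint_right, adjoint_sqrt_comp_sqrt hT]

theorem IsTraceClass.exists_eq_adjoint_comp {T : H →L[ℂ] H} (hT : IsTraceClass T) :
    ∃ A B : H →L[ℂ] H, IsHilbertSchmidt A ∧ IsHilbertSchmidt B ∧ T = A† ∘L B := by
  obtain ⟨U, hU⟩ := exists_comp_eq_of_norm_apply_le (A := T) (B := CFC.abs T) (C := 1)
    fun x => by rw [norm_abs_apply, one_mul]
  have hR : IsHilbertSchmidt (CFC.sqrt (CFC.abs T)) :=
    (posTrace_eq_hsNormSq_sqrt (CFC.abs_nonneg T)).symm.trans_lt hT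
  refine ⟨CFC.sqrt (CFC.abs T) ∘L U†, CFC.sqrt (CFC.abs T), hR.comp_right _, hR, ?_⟩
  rw [adjoint_comp, adjoint_adjoint, comp_assoc, adjoint_sqrt_comp_sqrt (CFC.abs_nonneg T), hU]

theorem IsHilbertSchmidt.isTraceClass_adjoint_comp {A B : H₁ →L[ℂ] H₂} (hA : IsHilbertSchmidt A)
    (hB : IsHilbertSchmidt B) : IsTraceClass (A† ∘L B) := by
  obtain ⟨W, hW⟩ := exists_comp_eq_of_norm_apply_le (A := CFC.abs (A† ∘L B)) (B := A† ∘L B) (C := 1)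
    fun x => by rw [norm_abs_apply, one_mul]
  have hsum := (hasSum_trace_adjoint_comp (hA.comp_right (W†)) hB (onbBasis H₁)).summable
  have hinner (e : onb H₁) :
      ⟪A ((W†) e), B e⟫_ℂ = ⟪(e : H₁), CFC.abs (A† ∘L B) e⟫_ℂ := by
    rw [← adjoint_inner_right A, adjoint_inner_left W, ← hW, comp_apply, comp_apply]
  simp only [comp_apply, onbBasis_apply, hinner] at hsum
  exact (Complex.hasSum_re hsum.hasSum).summable.tsum_ofReal_lt_top

theorem IsTraceClass.comp_right {T : H →L[ℂ] H} (hT : IsTraceClass T) (U : H →L[ℂ] H) :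
    IsTraceClass (T ∘L U) := by
  obtain ⟨A, B, hA, hB, rfl⟩ := hT.exists_eq_adjoint_comp
  rw [comp_assoc]
  exact hA.isTraceClass_adjoint_comp (hB.comp_right U)

theorem posTrace_rankOneOp (f : H) : posTrace (rankOneOp f) = ‖f‖ₑ ^ 2 := by
  simp only [posTrace, inner_rankOneOp, ← onbBasis_apply]
  rw [← tsum_enorm_inner_sq (onbBasis H) f]
  exact tsum_congr fun e => ofReal_norm_sq _

theorem isTraceClass_rankOneOp (f : H) : IsTraceClass (rankOneOp f) := by
  have hnonneg : 0 ≤ rankOneOp f := (nonneg_iff_isPositive _).2 (isPositive_rankOneOp f)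
  rw [IsTraceClass, CFC.abs_of_nonneg _ hnonneg, posTrace_rankOneOp]
  simp

end Traces

section Frames

variable {H H' ι : Type*}
  [NormedAddCommGroup H] [InnerProductSpace ℂ H]
  [NormedAddCommGroup H'] [InnerProductSpace ℂ H']

variable (ι) in
/-- The standard orthonormal basis of `ℓ²(ι)`. -/
def stdBasis : HilbertBasis ι ℂ (lp (fun _ : ι => ℂ) 2) := ⟨.refl ℂ _⟩

/-- A Bessel family with bound `1`, phrased with finite sums so that being Bessel is visibly a
closed condition. -/
def IsBessel (f : ι → H) : Prop := ∀ (a : H) (s : Finset ι), ∑ i ∈ s, ‖⟪f i, a⟫_ℂ‖ ^ 2 ≤ ‖a‖ ^ 2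

namespace IsBessel

variable {f : ι → H}

theorem of_dense {D : Set H} (hD : Dense D)
    (h : ∀ a ∈ D, ∀ s : Finset ι, ∑ i ∈ s, ‖⟪f i, a⟫_ℂ‖ ^ 2 ≤ ‖a‖ ^ 2) : IsBessel f := by
  refine fun a s => hD.induction (P := fun a => ∑ i ∈ s, ‖⟪f i, a⟫_ℂ‖ ^ 2 ≤ ‖a‖ ^ 2)
    (fun a ha => h a ha s) (isClosed_le ?_ ?_) a <;> fun_prop

theorem memℓp_inner (hf : IsBessel f) (a : H) : Memℓp (fun i => ⟪f i, a⟫_ℂ) 2 := by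
  refine memℓp_gen' (C := ‖a‖ ^ 2) fun s => ?_
  simpa using hf a s

/-- The analysis operator `a ↦ (⟨a, fᵢ⟩)ᵢ` of a Bessel family. -/
def analysis (hf : IsBessel f) : H →L[ℂ] lp (fun _ : ι => ℂ) 2 :=
  LinearMap.mkContinuous
    { toFun := fun a => ⟨fun i => ⟪f i, a⟫_ℂ, hf.memℓp_inner a⟩
      map_add' := fun a b => lp.ext (funext fun i => inner_add_right _ _ _)
      map_smul' := fun c a => lp.ext (funext fun i => inner_smul_right _ _ _) }
    1 fun a => by
      rw [one_mul]
      refine lp.norm_le_of_forall_sum_le (by norm_num) (norm_nonneg a) fun s => ?_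
      simpa using hf a s

theorem analysis_apply (hf : IsBessel f) (a : H) (i : ι) : hf.analysis a i = ⟪f i, a⟫_ℂ := rfl

theorem hasSum_norm_inner_sq (hf : IsBessel f) (a : H) :
    HasSum (fun i => ‖⟪f i, a⟫_ℂ‖ ^ 2) (‖hf.analysis a‖ ^ 2) := by
  simpa [analysis_apply] using lp.hasSum_norm (by norm_num) (hf.analysis a)

theorem adjoint_analysis_stdBasis [CompleteSpace H] (hf : IsBessel f) (i : ι) :
    (hf.analysis†) (stdBasis ι i) = f i := by
  refine ext_inner_right ℂ fun a => ?_
  rw [adjoint_inner_left, ← HilbertBasis.repr_apply_apply]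
  rfl

theorem countable_ne_zero [TopologicalSpace.SeparableSpace H] (hf : IsBessel f) :
    {i | f i ≠ 0}.Countable := by
  have hsupport (a : H) : {i | ⟪f i, a⟫_ℂ ≠ 0}.Countable := by
    simpa [Function.support] using (hf.hasSum_norm_inner_sq a).summable.countable_support
  refine (Set.countable_iUnion fun n => hsupport (TopologicalSpace.denseSeq H n)).mono
    fun i hi => ?_
  contrapose! hi
  simp only [Set.mem_iUnion, Set.mem_ofPred_eq, not_exists, not_not] at hi
  refine Set.notMem_ofPred_iff.2 (not_not.2 <| ext_inner_right ℂ fun a => ?_)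
  rw [inner_zero_left]
  refine (TopologicalSpace.denseRange_denseSeq H).induction_on
    (p := fun a => ⟪f i, a⟫_ℂ = 0) a (isClosed_eq ?_ ?_) hi <;> fun_prop

end IsBessel

section NTF

variable {f : ι → H} {K : ClosedSubmodule ℂ H} [CompleteSpace H]

theorem proj_eq_self {x : H} (hx : x ∈ K) : proj K x = x :=
  Submodule.starProjection_eq_self_iff.2 hx

theorem proj_mem (x : H) : proj K x ∈ K :=
  Submodule.starProjection_apply_mem _ x

theorem adjoint_proj : (proj K)† = proj K :=
  isSelfAdjoint_starProjection K.toSubmodule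

theorem proj_comp_proj : proj K ∘L proj K = proj K :=
  ext fun x => proj_eq_self (proj_mem x)

theorem norm_proj_apply_le (x : H) : ‖proj K x‖ ≤ ‖x‖ :=
  Submodule.norm_starProjection_apply_le _ x

theorem inner_proj_of_mem {x : H} (hx : x ∈ K) (a : H) : ⟪x, proj K a⟫_ℂ = ⟪x, a⟫_ℂ := by
  rw [← adjoint_inner_left, adjoint_proj, proj_eq_self hx]

namespace IsNTF

theorem hasSum_norm_inner_sq (hf : IsNTF K f) (a : H) :
    HasSum (fun i => ‖⟪f i, a⟫_ℂ‖ ^ 2) (‖proj K a‖ ^ 2) := by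
  refine (hf.2 _ (proj_mem a)).congr_fun fun i => ?_
  rw [← inner_proj_of_mem (hf.1 i), norm_inner_symm]

theorem isBessel (hf : IsNTF K f) : IsBessel f := fun a s =>
  (sum_le_hasSum s (fun _ _ => sq_nonneg _) (hf.hasSum_norm_inner_sq a)).trans
    (pow_le_pow_left₀ (norm_nonneg _) (norm_proj_apply_le a) 2)

theorem norm_analysis_apply (hf : IsNTF K f) (a : H) : ‖hf.isBessel.analysis a‖ = ‖proj K a‖ :=
  (sq_eq_sq₀ (norm_nonneg _) (norm_nonneg _)).1 <|
    (hf.isBessel.hasSum_norm_inner_sq a).unique (hf.hasSum_norm_inner_sq a)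

theorem adjoint_analysis_comp_analysis (hf : IsNTF K f) :
    (hf.isBessel.analysis)† ∘L hf.isBessel.analysis = proj K := by
  rw [adjoint_comp_self_eq_iff.2 hf.norm_analysis_apply, adjoint_proj, proj_comp_proj]

theorem of_dense {D : Set H} (hD : Dense D) (hmem : ∀ i, f i ∈ K)
    (h : ∀ a ∈ D, HasSum (fun i => ‖⟪f i, a⟫_ℂ‖ ^ 2) (‖proj K a‖ ^ 2)) : IsNTF K f := by
  have hf : IsBessel f := .of_dense hD fun a ha s =>
    (sum_le_hasSum s (fun _ _ => sq_nonneg _) (h a ha)).trans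
      (pow_le_pow_left₀ (norm_nonneg _) (norm_proj_apply_le a) 2)
  have hnorm (a : H) : ‖hf.analysis a‖ ^ 2 = ‖proj K a‖ ^ 2 := by
    refine hD.induction (P := fun a => ‖hf.analysis a‖ ^ 2 = ‖proj K a‖ ^ 2)
      (fun a ha => (hf.hasSum_norm_inner_sq a).unique (h a ha)) (isClosed_eq ?_ ?_) a <;> fun_prop
  refine ⟨hmem, fun a ha => ?_⟩
  simpa only [norm_inner_symm, hnorm, proj_eq_self ha] using hf.hasSum_norm_inner_sq a

theorem posTrace_proj_comp (hf : IsNTF K f) {T : H →L[ℂ] H} (hT : T.IsPositive) :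
    posTrace (proj K ∘L T ∘L proj K) =
      ∑' i, ENNReal.ofReal (RCLike.re ⟪f i, T (f i)⟫_ℂ) := by
  have hT₀ : 0 ≤ T := (nonneg_iff_isPositive T).2 hT
  set R := CFC.sqrt T
  have hR : R† = R := adjoint_eq_self_of_nonneg (CFC.sqrt_nonneg T)
  have hfactor : proj K ∘L T ∘L proj K = (R ∘L proj K)† ∘L (R ∘L proj K) := by
    rw [adjoint_comp, adjoint_proj, ← adjoint_sqrt_comp_sqrt hT₀, comp_assoc, comp_assoc]
  calc posTrace (proj K ∘L T ∘L proj K)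
      = hsNormSq (R ∘L proj K) := by rw [hfactor, posTrace_adjoint_comp_self]
    _ = hsNormSq (proj K ∘L R) := by rw [← hsNormSq_adjoint, adjoint_comp, hR, adjoint_proj]
    _ = hsNormSq (hf.isBessel.analysis ∘L R) :=
        hsNormSq_congr_norm fun x => (hf.norm_analysis_apply (R x)).symm
    _ = hsNormSq (R ∘L hf.isBessel.analysis†) := by rw [← hsNormSq_adjoint, adjoint_comp, hR]
    _ = ∑' i, ‖R (f i)‖ₑ ^ 2 := by
        rw [hsNormSq_eq_tsum _ (stdBasis ι)]
        simp only [comp_apply, IsBessel.adjoint_analysis_stdBasis]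
    _ = ∑' i, ENNReal.ofReal (RCLike.re ⟪f i, T (f i)⟫_ℂ) := by
        simp only [ofReal_re_inner_eq_enorm_sqrt_sq hT₀, R]

theorem hasSum_trace_comp_proj (hf : IsNTF K f) {T : H →L[ℂ] H} (hT : IsTraceClass T) :
    HasSum (fun i => ⟪f i, T (f i)⟫_ℂ) (trace (T ∘L proj K)) := by
  obtain ⟨A, B, hA, hB, rfl⟩ := hT.exists_eq_adjoint_comp
  set Θ := hf.isBessel.analysis
  have hAΘ : IsHilbertSchmidt (A ∘L Θ†) := hA.comp_right _
  have hBΘ : IsHilbertSchmidt (B ∘L Θ†) := hB.comp_right _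
  have htrace : trace ((A ∘L Θ†)† ∘L (B ∘L Θ†)) = trace ((A† ∘L B) ∘L proj K) :=
    calc trace ((A ∘L Θ†)† ∘L (B ∘L Θ†))
        = trace ((B ∘L Θ†) ∘L (A ∘L Θ†)†) := trace_adjoint_comp_comm hAΘ hBΘ
      _ = trace ((B ∘L proj K) ∘L A†) := by
          rw [adjoint_comp, adjoint_adjoint, ← hf.adjoint_analysis_comp_analysis]
          rfl
      _ = trace (A† ∘L (B ∘L proj K)) := (trace_adjoint_comp_comm hA (hB.comp_right _)).symm
  rw [← htrace]
  simpa only [comp_apply, adjoint_inner_right, Θ, IsBessel.adjoint_analysis_stdBasis] using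
    hasSum_trace_adjoint_comp hAΘ hBΘ (stdBasis ι)

end IsNTF

end NTF

theorem IsNTF.map_unitary {f : ι → H} {K : ClosedSubmodule ℂ H} {K' : ClosedSubmodule ℂ H'}
    (hf : IsNTF K f) (U : H ≃ₗᵢ[ℂ] H') (hK : (K' : Set H') = U '' K) :
    IsNTF K' (fun i => U (f i)) := by
  have hmem (a : H') : a ∈ K' ↔ a ∈ U '' K := by rw [← hK, SetLike.mem_coe]
  refine ⟨fun i => (hmem _).2 (Set.mem_image_of_mem U (hf.1 i)), fun a ha => ?_⟩
  obtain ⟨a, haK, rfl⟩ := (hmem a).1 ha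
  simpa only [LinearIsometryEquiv.inner_map_map, LinearIsometryEquiv.norm_map] using hf.2 a haK

end Frames

section Fourier

theorem integrable_inner_of_memLp {α E : Type*} [MeasurableSpace α] {μ : Measure α}
    [NormedAddCommGroup E] [InnerProductSpace ℂ E] {f g : α → E} (hf : MemLp f 2 μ)
    (hg : MemLp g 2 μ) : Integrable (fun x => ⟪f x, g x⟫_ℂ) μ := by
  refine (L2.integrable_inner (𝕜 := ℂ) hf.toLp hg.toLp).congr ?_
  filter_upwards [hf.coeFn_toLp, hg.coeFn_toLp] with x hfx hgx
  rw [hfx, hgx]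

theorem memLp_comp_mul_left {E : Type*} [NormedAddCommGroup E] {F : ℝ → E} {p : ℝ≥0∞}
    (hF : MemLp F p) {a : ℝ} (ha : a ≠ 0) : MemLp (fun x => F (a * x)) p := by
  refine MemLp.comp_of_map ?_ (by fun_prop)
  rw [Real.map_volume_mul_left ha]
  exact hF.smul_measure ENNReal.ofReal_ne_top

theorem memLp_modulation (a : ℝ) :
    MemLp (fun s : ℝ => Complex.exp (-(Complex.I * a * (2 * Real.pi * s)))) ∞ := by
  refine memLp_top_of_bound (Continuous.aestronglyMeasurable (by fun_prop)) 1
    (Eventually.of_forall fun s => le_of_eq ?_)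
  rw [Complex.norm_exp]
  simp

theorem fourier_compSubConstCLM (a : ℝ) (f : SchwartzMap ℝ ℂ) (s : ℝ) :
    𝓕 (f.compSubConstCLM ℂ a) s = Complex.exp (-(Complex.I * a * (2 * Real.pi * s))) * 𝓕 f s := by
  rw [SchwartzMap.fourier_coe, SchwartzMap.fourier_coe, Real.fourier_real_eq_integral_exp_smul,
    Real.fourier_real_eq_integral_exp_smul, ← integral_const_mul,
    ← integral_add_right_eq_self _ a]
  refine integral_congr_ae (Eventually.of_forall fun x => ?_)
  simp only [SchwartzMap.compSubConstCLM_apply, smul_eq_mul, add_sub_cancel_right]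
  rw [← mul_assoc, ← Complex.exp_add]
  congr 2
  push_cast
  ring

/-- Translation by `a` on `L²(ℝ)`. -/
abbrev translate (a : ℝ) (f : Lp ℂ 2 (volume : Measure ℝ)) : Lp ℂ 2 (volume : Measure ℝ) :=
  Lp.compMeasurePreserving (fun x => x - a) (measurePreserving_sub_right volume a) f

theorem fourier_translate (a : ℝ) (f : Lp ℂ 2 (volume : Measure ℝ)) :
    (𝓕 (translate a f) : Lp ℂ 2 (volume : Measure ℝ)) =ᵐ[volume]
      fun s => Complex.exp (-(Complex.I * a * (2 * Real.pi * s))) * (𝓕 f : Lp ℂ 2 volume) s := by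
  let M : Lp ℂ 2 (volume : Measure ℝ) →L[ℂ] Lp ℂ 2 (volume : Measure ℝ) :=
    (ContinuousLinearMap.mul ℂ ℂ).holderL volume ∞ 2 2 (memLp_modulation a).toLp
  have hM (g : Lp ℂ 2 (volume : Measure ℝ)) : M g =ᵐ[volume]
      fun s => Complex.exp (-(Complex.I * a * (2 * Real.pi * s))) * g s := by
    filter_upwards [(ContinuousLinearMap.mul ℂ ℂ).coeFn_holder (r := 2) (memLp_modulation a).toLp g,
      (memLp_modulation a).coeFn_toLp] with s hholder hmod
    refine hholder.trans ?_
    rw [hmod]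
    rfl
  suffices hFM : 𝓕 (translate a f) = M (𝓕 f) by
    rw [hFM]
    exact hM _
  refine DenseRange.induction_on (p := fun f => 𝓕 (translate a f) = M (𝓕 f))
    (SchwartzMap.denseRange_toLpCLM (F := ℂ) (μ := (volume : Measure ℝ)) (p := 2)
      ENNReal.ofNat_ne_top) f ?_ fun g => Lp.ext ?_
  · exact isClosed_eq ((Lp.fourierTransformₗᵢ ℝ ℂ).continuous.comp
      (Lp.isometry_compMeasurePreserving _).continuous)
      (M.continuous.comp (Lp.fourierTransformₗᵢ ℝ ℂ).continuous)
  · have htranslate : translate a (g.toLp 2) = (g.compSubConstCLM ℂ a).toLp 2 := rfl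
    simp only [SchwartzMap.toLpCLM_apply, htranslate, SchwartzMap.toLp_fourier_eq]
    filter_upwards [hM ((𝓕 g).toLp 2), (𝓕 (g.compSubConstCLM ℂ a)).coeFn_toLp 2 volume,
      (𝓕 g).coeFn_toLp 2 volume] with s hmul htranslated horiginal
    rw [hmul, htranslated, horiginal, fourier_compSubConstCLM]

theorem quasiMeasurePreserving_div {a : ℝ} (ha : a ≠ 0) :
    Measure.QuasiMeasurePreserving (fun x : ℝ => x / a) := by
  simpa only [div_eq_inv_mul] using!
    Measure.quasiMeasurePreserving_smul volume (inv_ne_zero ha)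

theorem memLp_hat (f : Lp ℂ 2 (volume : Measure ℝ)) : MemLp (hat f) 2 := by
  have hcomp := memLp_comp_mul_left (Lp.memLp (𝓕 f)) (inv_ne_zero Real.two_pi_pos.ne')
  simp only [← div_eq_inv_mul] at hcomp
  exact hcomp

theorem hat_smul (c : ℂ) (f : Lp ℂ 2 (volume : Measure ℝ)) :
    hat (c • f) =ᵐ[volume] fun ξ => c * hat f ξ := by
  have hsmul : 𝓕 (c • f) = c • 𝓕 f := (Lp.fourierTransformₗᵢ ℝ ℂ).map_smul c f
  simp only [Filter.EventuallyEq, hat, hsmul]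
  exact (quasiMeasurePreserving_div Real.two_pi_pos.ne').ae (Lp.coeFn_smul c (𝓕 f))

theorem hat_translate (a : ℝ) (f : Lp ℂ 2 (volume : Measure ℝ)) :
    hat (translate a f) =ᵐ[volume] fun ξ => Complex.exp (-(Complex.I * a * ξ)) * hat f ξ := by
  filter_upwards [(quasiMeasurePreserving_div Real.two_pi_pos.ne').ae (fourier_translate a f)]
    with ξ hξ
  rw [hat, hξ, hat]
  push_cast
  rw [mul_div_cancel₀ (ξ : ℂ) (by simp [Real.pi_ne_zero])]

theorem integral_inner_hat (f g : Lp ℂ 2 (volume : Measure ℝ)) :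
    ∫ ξ, ⟪hat f ξ, hat g ξ⟫_ℂ = 2 * Real.pi * ⟪f, g⟫_ℂ := by
  simp only [hat]
  rw [Measure.integral_comp_div (fun s => ⟪(𝓕 f : Lp ℂ 2 (volume : Measure ℝ)) s,
    (𝓕 g : Lp ℂ 2 (volume : Measure ℝ)) s⟫_ℂ), ← L2.inner_def, Lp.inner_fourier_eq,
    abs_of_pos Real.two_pi_pos, Complex.real_smul]
  push_cast
  rfl

theorem exists_hat_ae_eq {F : ℝ → ℂ} (hF : MemLp F 2) :
    ∃ f : Lp ℂ 2 (volume : Measure ℝ), hat f =ᵐ[volume] F := by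
  have hG := memLp_comp_mul_left hF Real.two_pi_pos.ne'
  refine ⟨𝓕⁻ hG.toLp, ?_⟩
  filter_upwards [(quasiMeasurePreserving_div Real.two_pi_pos.ne').ae hG.coeFn_toLp] with ξ hξ
  rw [hat, FourierTransform.fourier_fourierInv_eq, hξ, mul_div_cancel₀ ξ Real.two_pi_pos.ne']

variable {n : ℕ} (θ : Fin n → ℝ)

/-- The function `ξ ↦ φ̂_j(ξ - θ_j)`, whose periodization is the `j`-th component of the fibers
of `φ`. -/
def twistedHat (φ : L2n n) (j : Fin n) (ξ : ℝ) : ℂ := hat (φ j) (ξ - θ j)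

theorem memLp_twistedHat (φ : L2n n) (j : Fin n) : MemLp (twistedHat θ φ j) 2 :=
  (memLp_hat (φ j)).comp_measurePreserving (measurePreserving_sub_right volume (θ j))

theorem shift_zero (φ : L2n n) : shift θ 0 φ = φ := by
  ext1 j
  refine Lp.ext ?_
  simp only [shift, Int.cast_zero, mul_zero, zero_mul, neg_zero, Complex.exp_zero, one_smul]
  filter_upwards [Lp.coeFn_compMeasurePreserving (φ j) (measurePreserving_sub_right volume 0)]
    with x hx
  rw [hx]
  simp

theorem twistedHat_shift (k : ℤ) (φ : L2n n) (j : Fin n) :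
    twistedHat θ (shift θ k φ) j =ᵐ[volume]
      fun ξ => Complex.exp (-(Complex.I * k * ξ)) * twistedHat θ φ j ξ := by
  have hhat : hat (shift θ k φ j) =ᵐ[volume] fun ξ =>
      Complex.exp (-(Complex.I * k * (ξ + θ j))) * hat (φ j) ξ := by
    filter_upwards [hat_smul (Complex.exp (-(Complex.I * k * θ j))) (translate k (φ j)),
      hat_translate k (φ j)] with ξ hsmul htranslate
    refine hsmul.trans ?_
    rw [htranslate, ← mul_assoc, ← Complex.exp_add]
    congr 2
    push_cast
    ring
  filter_upwards [(measurePreserving_sub_right volume (θ j)).quasiMeasurePreserving.ae hhat]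
    with ξ hξ
  simp only [twistedHat, hξ, Complex.ofReal_sub, sub_add_cancel]

theorem integrable_inner_twistedHat (φ ψ : L2n n) (j : Fin n) :
    Integrable fun ξ => ⟪twistedHat θ φ j ξ, twistedHat θ ψ j ξ⟫_ℂ :=
  integrable_inner_of_memLp (memLp_twistedHat θ φ j) (memLp_twistedHat θ ψ j)

theorem sum_integral_inner_twistedHat (φ ψ : L2n n) :
    ∑ j, ∫ ξ, ⟪twistedHat θ φ j ξ, twistedHat θ ψ j ξ⟫_ℂ = 2 * Real.pi * ⟪φ, ψ⟫_ℂ := by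
  rw [PiLp.inner_apply, Finset.mul_sum]
  refine Finset.sum_congr rfl fun j _ => ?_
  rw [← integral_inner_hat]
  exact integral_sub_right_eq_self (fun ξ => ⟪hat (φ j) ξ, hat (ψ j) ξ⟫_ℂ) (θ j)

theorem exists_twistedHat_ae_eq {F : Fin n → ℝ → ℂ} (hF : ∀ j, MemLp (F j) 2) :
    ∃ φ : L2n n, ∀ j, twistedHat θ φ j =ᵐ[volume] F j := by
  have hF' (j : Fin n) : MemLp (fun ξ => F j (ξ + θ j)) 2 :=
    (hF j).comp_measurePreserving (measurePreserving_add_right volume (θ j))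
  choose f hf using fun j => exists_hat_ae_eq (hF' j)
  refine ⟨WithLp.toLp 2 f, fun j => ?_⟩
  filter_upwards [(measurePreserving_sub_right volume (θ j)).quasiMeasurePreserving.ae (hf j)]
    with ξ hξ
  rw [twistedHat, hξ, sub_add_cancel]

end Fourier

section Periodization

variable {T : ℝ} (hT : 0 < T)

theorem measurableEmbedding_add_mul (T : ℝ) (k : ℤ) :
    MeasurableEmbedding fun x : ℝ => x + k * T :=
  measurableEmbedding_addRight (k * T)

include hT

theorem volume_eq_sum_map : (volume : Measure ℝ) =
    Measure.sum fun k : ℤ => (volume.restrict (Set.Ioc 0 T)).map fun x => x + k * T := by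
  conv_lhs => rw [← Measure.restrict_univ (μ := (volume : Measure ℝ)),
    ← iUnion_Ioc_add_zsmul hT 0, Measure.restrict_iUnion (Set.pairwise_disjoint_Ioc_add_zsmul 0 T)
      fun _ => measurableSet_Ioc]
  congr 1
  ext1 k
  have htranslate := (measurePreserving_add_right volume (k * T)).restrict_preimage
    (measurableSet_Ioc (a := 0 + k • T) (b := 0 + (k + 1) • T))
  rw [← htranslate.map_eq, Set.preimage_add_const_Ioc]
  congr 3 <;> simp [add_mul]

theorem ae_iff_ae_forall_int {p : ℝ → Prop} :
    (∀ᵐ x, p x) ↔ ∀ᵐ x ∂volume.restrict (Set.Ioc 0 T), ∀ k : ℤ, p (x + k * T) := by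
  conv_lhs => rw [volume_eq_sum_map hT]
  rw [Measure.ae_sum_iff, ae_all_iff]
  exact forall_congr' fun k => (measurableEmbedding_add_mul T k).ae_map_iff

omit hT in
theorem quasiMeasurePreserving_add_mul (k : ℤ) :
    Measure.QuasiMeasurePreserving (fun x : ℝ => x + k * T)
      (volume.restrict (Set.Ioc 0 T)) volume :=
  (measurePreserving_add_right volume (k * T)).quasiMeasurePreserving.mono_left
    Measure.restrict_le_self.absolutelyContinuous

theorem lintegral_eq_lintegral_tsum {F : ℝ → ℝ≥0∞} (hF : AEMeasurable F) :
    ∫⁻ x, F x = ∫⁻ x in Set.Ioc 0 T, ∑' k : ℤ, F (x + k * T) := by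
  have hmeas (k : ℤ) : AEMeasurable (fun x => F (x + k * T)) (volume.restrict (Set.Ioc 0 T)) :=
    hF.comp_quasiMeasurePreserving (quasiMeasurePreserving_add_mul k)
  rw [lintegral_tsum hmeas]
  conv_lhs => rw [volume_eq_sum_map hT, lintegral_sum_measure]
  exact tsum_congr fun k => (measurableEmbedding_add_mul T k).lintegral_map _

theorem lintegral_tsum_enorm_lt_top {E : Type*} [NormedAddCommGroup E] {F : ℝ → E}
    (hF : Integrable F) : ∫⁻ x in Set.Ioc 0 T, ∑' k : ℤ, ‖F (x + k * T)‖ₑ < ∞ :=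
  (lintegral_eq_lintegral_tsum hT hF.1.enorm).symm.trans_lt hF.2

theorem integrable_tsum_add_mul {F : ℝ → ℂ} (hF : Integrable F) :
    Integrable (fun x => ∑' k : ℤ, F (x + k * T)) (volume.restrict (Set.Ioc 0 T)) := by
  refine ⟨AEMeasurable.aestronglyMeasurable <| .tsum fun k =>
    (hF.1.comp_quasiMeasurePreserving (quasiMeasurePreserving_add_mul k)).aemeasurable, ?_⟩
  exact (lintegral_mono fun x => enorm_tsum_le_tsum_enorm).trans_lt
    (lintegral_tsum_enorm_lt_top hT hF)

theorem integral_eq_integral_tsum {E : Type*} [NormedAddCommGroup E] [NormedSpace ℝ E]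
    {F : ℝ → E} (hF : Integrable F) :
    ∫ x, F x = ∫ x in Set.Ioc 0 T, ∑' k : ℤ, F (x + k * T) := by
  have hmeas (k : ℤ) : AEStronglyMeasurable (fun x => F (x + k * T))
      (volume.restrict (Set.Ioc 0 T)) :=
    hF.1.comp_quasiMeasurePreserving (quasiMeasurePreserving_add_mul k)
  have hfin := lintegral_tsum_enorm_lt_top hT hF
  rw [lintegral_tsum fun k => (hmeas k).enorm] at hfin
  rw [integral_tsum hmeas hfin.ne]
  rw [volume_eq_sum_map hT] at hF
  conv_lhs => rw [volume_eq_sum_map hT, integral_sum_measure hF]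
  exact tsum_congr fun k => (measurableEmbedding_add_mul T k).integral_map _

theorem ae_memℓp_add_mul {E : Type*} [NormedAddCommGroup E] {F : ℝ → E} {p : ℝ≥0∞} (hp : p ≠ 0)
    (hp' : p ≠ ∞) (hF : MemLp F p) :
    ∀ᵐ x ∂volume.restrict (Set.Ioc 0 T), Memℓp (fun k : ℤ => F (x + k * T)) p := by
  have hmeas : AEMeasurable fun x => ‖F x‖ₑ ^ p.toReal := hF.1.enorm.pow_const _
  have hfin := (eLpNorm_lt_top_iff_lintegral_rpow_enorm_lt_top hp hp').1 hF.2
  rw [lintegral_eq_lintegral_tsum hT hmeas] at hfin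
  have hmeas' : AEMeasurable (fun x => ∑' k : ℤ, ‖F (x + k * T)‖ₑ ^ p.toReal)
      (volume.restrict (Set.Ioc 0 T)) :=
    .tsum fun k => hmeas.comp_quasiMeasurePreserving (quasiMeasurePreserving_add_mul k)
  filter_upwards [ae_lt_top' hmeas' hfin.ne] with x hx
  refine memℓp_gen ((ENNReal.summable_toReal hx.ne).congr fun k => ?_)
  rw [← ENNReal.toReal_rpow, toReal_enorm]

theorem exists_measurable_add_mul_eq {E : Type*} [MeasurableSpace E] {G : ℤ → ℝ → E}
    (hG : ∀ k, Measurable (G k)) :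
    ∃ F : ℝ → E, Measurable F ∧ ∀ x ∈ Set.Ioc 0 T, ∀ k : ℤ, F (x + k * T) = G k x := by
  let d (x : ℝ) : ℤ := ⌈x / T⌉ - 1
  have hd : Measurable d := by fun_prop
  refine ⟨fun x => G (d x) (x - d x * T), ?_, fun x hx k => ?_⟩
  · have hG' : Measurable fun p : ℤ × ℝ => G p.1 p.2 := measurable_from_prod_countable_right hG
    exact hG'.comp (hd.prodMk (by fun_prop))
  · have hdx : d (x + k * T) = k := by
      have hceil : ⌈x / T⌉ = 1 :=
        Int.ceil_eq_iff.2 ⟨by simpa using div_pos hx.1 hT, by simpa using (div_le_one hT).2 hx.2⟩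
      simp only [d, add_div, mul_div_cancel_right₀ _ hT.ne', Int.ceil_add_intCast, hceil]
      ring
    simp only [hdx, add_sub_cancel_right]

omit hT in
theorem tsum_enorm_fourierCoeffOn_sq {a b : ℝ} (hab : a < b) {f : ℝ → ℂ}
    (hf : MemLp f 2 (volume.restrict (Set.Ioc a b))) :
    ENNReal.ofReal (b - a) * ∑' k, ‖fourierCoeffOn hab f k‖ₑ ^ 2 =
      ∫⁻ x in Set.Ioc a b, ‖f x‖ₑ ^ 2 := by
  have hsum := hasSum_sq_fourierCoeffOn hab hf
  rw [intervalIntegral.integral_of_le hab.le, smul_eq_mul] at hsum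
  have hint : Integrable (fun x => ‖f x‖ ^ 2) (volume.restrict (Set.Ioc a b)) :=
    (memLp_two_iff_integrable_sq_norm hf.1).1 hf
  simp only [← ofReal_norm_sq]
  rw [← ENNReal.ofReal_tsum_of_nonneg (fun _ => sq_nonneg _) hsum.summable, hsum.tsum_eq,
    ← ENNReal.ofReal_mul (sub_pos.2 hab).le, mul_inv_cancel_left₀ (sub_pos.2 hab).ne',
    ofReal_integral_eq_lintegral_ofReal hint (ae_of_all _ fun _ => sq_nonneg _)]

end Periodization

section Fiberization

theorem memLp_two_of_lintegral_enorm_sq {α E : Type*} [MeasurableSpace α] {μ : Measure α}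
    [NormedAddCommGroup E] {f : α → E} (hf : AEStronglyMeasurable f μ)
    (hfin : ∫⁻ x, ‖f x‖ₑ ^ 2 ∂μ < ∞) : MemLp f 2 μ := by
  refine ⟨hf, (eLpNorm_lt_top_iff_lintegral_rpow_enorm_lt_top two_ne_zero
    ENNReal.ofNat_ne_top).2 ?_⟩
  simpa using hfin

/-- Lebesgue measure on the fundamental domain `(0, 2π]` of the translations by `2πℤ`. -/
abbrev circleMeasure : Measure ℝ := volume.restrict (Set.Ioc 0 (2 * Real.pi))

variable {n : ℕ} (θ : Fin n → ℝ)

theorem fiber_apply_ae (φ : L2n n) : ∀ᵐ ξ ∂circleMeasure, ∀ j, ∀ k : ℤ,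
    fiber θ φ ξ j k = twistedHat θ φ j (ξ + k * (2 * Real.pi)) := by
  refine ae_all_iff.2 fun j => ?_
  filter_upwards [ae_memℓp_add_mul Real.two_pi_pos two_ne_zero ENNReal.ofNat_ne_top
    (memLp_twistedHat θ φ j)] with ξ hξ k
  have harg (k : ℤ) : ξ - θ j + 2 * k * Real.pi = ξ + k * (2 * Real.pi) - θ j := by ring
  have hmem : Memℓp (fun k : ℤ => hat (φ j) (ξ - θ j + 2 * k * Real.pi)) 2 := by
    simp only [harg]
    exact hξ
  simp only [fiber, fiber₁, dif_pos hmem, harg, twistedHat]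

theorem exp_neg_I_mul_add_two_pi (k m : ℤ) (ξ : ℝ) :
    Complex.exp (-(Complex.I * k * (ξ + m * (2 * Real.pi) : ℝ))) =
      Complex.exp (-(Complex.I * k * ξ)) := by
  have harg : -(Complex.I * k * (ξ + m * (2 * Real.pi) : ℝ)) =
      -(Complex.I * k * ξ) + (-(k * m) : ℤ) * (2 * Real.pi * Complex.I) := by
    push_cast
    ring
  rw [harg, Complex.exp_add, Complex.exp_int_mul_two_pi_mul_I, mul_one]

theorem fiber_shift_ae (k : ℤ) (φ : L2n n) : ∀ᵐ ξ ∂circleMeasure,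
    fiber θ (shift θ k φ) ξ = Complex.exp (-(Complex.I * k * ξ)) • fiber θ φ ξ := by
  have hshift := ae_all_iff.2 fun j =>
    (ae_iff_ae_forall_int Real.two_pi_pos).1 (twistedHat_shift θ k φ j)
  filter_upwards [fiber_apply_ae θ φ, fiber_apply_ae θ (shift θ k φ), hshift] with ξ hφ hshiftφ hξ
  ext j m
  rw [hshiftφ, hξ, exp_neg_I_mul_add_two_pi, ← hφ]
  rfl

theorem inner_fiber_ae (φ ψ : L2n n) : ∀ᵐ ξ ∂circleMeasure,
    ∑ j, ∑' k : ℤ, ⟪twistedHat θ φ j (ξ + k * (2 * Real.pi)),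
      twistedHat θ ψ j (ξ + k * (2 * Real.pi))⟫_ℂ = ⟪fiber θ φ ξ, fiber θ ψ ξ⟫_ℂ := by
  filter_upwards [fiber_apply_ae θ φ, fiber_apply_ae θ ψ] with ξ hφ hψ
  simp only [PiLp.inner_apply, lp.inner_eq_tsum, hφ, hψ]

theorem integrable_inner_fiber (φ ψ : L2n n) :
    Integrable (fun ξ => ⟪fiber θ φ ξ, fiber θ ψ ξ⟫_ℂ) circleMeasure :=
  (integrable_finsetSum _ fun j _ => integrable_tsum_add_mul Real.two_pi_pos
    (integrable_inner_twistedHat θ φ ψ j)).congr (inner_fiber_ae θ φ ψ)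

theorem integral_inner_fiber (φ ψ : L2n n) :
    ∫ ξ, ⟪fiber θ φ ξ, fiber θ ψ ξ⟫_ℂ ∂circleMeasure = 2 * Real.pi * ⟪φ, ψ⟫_ℂ := by
  have hint (j : Fin n) := integrable_inner_twistedHat θ φ ψ j
  rw [← integral_congr_ae (inner_fiber_ae θ φ ψ),
    integral_finsetSum _ fun j _ => integrable_tsum_add_mul Real.two_pi_pos (hint j),
    ← sum_integral_inner_twistedHat θ]
  exact Finset.sum_congr rfl fun j _ => (integral_eq_integral_tsum Real.two_pi_pos (hint j)).symm

theorem fourierCoeffOn_inner_fiber (φ ψ : L2n n) (k : ℤ) :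
    fourierCoeffOn Real.two_pi_pos (fun ξ => ⟪fiber θ φ ξ, fiber θ ψ ξ⟫_ℂ) k =
      ⟪φ, shift θ k ψ⟫_ℂ := by
  have hpi : (Real.pi : ℂ) ≠ 0 := Complex.ofReal_ne_zero.2 Real.pi_ne_zero
  have hintegrand : (fun ξ : ℝ => fourier (-k) (ξ : AddCircle (2 * Real.pi - 0)) •
      ⟪fiber θ φ ξ, fiber θ ψ ξ⟫_ℂ) =ᵐ[circleMeasure]
      fun ξ => ⟪fiber θ φ ξ, fiber θ (shift θ k ψ) ξ⟫_ℂ := by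
    filter_upwards [fiber_shift_ae θ k ψ] with ξ hξ
    rw [hξ, inner_smul_right, fourier_coe_apply, smul_eq_mul]
    congr 2
    push_cast
    field_simp
    ring
  rw [fourierCoeffOn_eq_integral, intervalIntegral.integral_of_le Real.two_pi_pos.le,
    integral_congr_ae hintegrand, integral_inner_fiber, Complex.real_smul]
  push_cast
  field_simp
  ring

theorem lintegral_enorm_fiber_sq (φ : L2n n) :
    ∫⁻ ξ, ‖fiber θ φ ξ‖ₑ ^ 2 ∂circleMeasure = ENNReal.ofReal (2 * Real.pi) * ‖φ‖ₑ ^ 2 := by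
  have hre (x : L2Zn n) : RCLike.re ⟪x, x⟫_ℂ = ‖x‖ ^ 2 := inner_self_eq_norm_sq x
  have hint := (integrable_inner_fiber θ φ φ).re
  have hintegral := integral_re (integrable_inner_fiber θ φ φ)
  simp only [hre] at hint hintegral
  simp only [← ofReal_norm_sq]
  rw [← ofReal_integral_eq_lintegral_ofReal hint (ae_of_all _ fun _ => sq_nonneg _), hintegral,
    integral_inner_fiber, ← ENNReal.ofReal_mul Real.two_pi_pos.le]
  norm_cast
  rw [RCLike.re_eq_complex_re, Complex.re_ofReal_mul, ← RCLike.re_eq_complex_re,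
    inner_self_eq_norm_sq]

theorem ofReal_mul_tsum_enorm_inner_shift_sq (φ ψ : L2n n) {C : ℝ}
    (hC : ∀ᵐ ξ ∂circleMeasure, ‖fiber θ φ ξ‖ ≤ C) :
    ENNReal.ofReal (2 * Real.pi) * ∑' k, ‖⟪φ, shift θ k ψ⟫_ℂ‖ₑ ^ 2 =
      ∫⁻ ξ, ‖⟪fiber θ φ ξ, fiber θ ψ ξ⟫_ℂ‖ₑ ^ 2 ∂circleMeasure := by
  have hmem : MemLp (fun ξ => ⟪fiber θ φ ξ, fiber θ ψ ξ⟫_ℂ) 2 circleMeasure := by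
    refine memLp_two_of_lintegral_enorm_sq (integrable_inner_fiber θ φ ψ).1 ?_
    calc ∫⁻ ξ, ‖⟪fiber θ φ ξ, fiber θ ψ ξ⟫_ℂ‖ₑ ^ 2 ∂circleMeasure
        ≤ ∫⁻ ξ, ENNReal.ofReal C ^ 2 * ‖fiber θ ψ ξ‖ₑ ^ 2 ∂circleMeasure := by
          refine lintegral_mono_ae ?_
          filter_upwards [hC] with ξ hξ
          rw [← mul_pow]
          gcongr
          rw [← ofReal_norm, ← ofReal_norm, ← ENNReal.ofReal_mul' (norm_nonneg _)]
          refine ENNReal.ofReal_le_ofReal ((norm_inner_le_norm _ _).trans ?_)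
          gcongr
      _ = ENNReal.ofReal C ^ 2 * (ENNReal.ofReal (2 * Real.pi) * ‖ψ‖ₑ ^ 2) := by
          rw [lintegral_const_mul' _ _ (by simp), lintegral_enorm_fiber_sq]
      _ < ∞ := by finiteness
  have hparseval := tsum_enorm_fourierCoeffOn_sq Real.two_pi_pos hmem
  simpa only [fourierCoeffOn_inner_fiber, sub_zero] using hparseval

theorem tsum_enorm_apply_sq {ι : Type*} (x : lp (fun _ : ι => ℂ) 2) :
    ∑' i, ‖x i‖ₑ ^ 2 = ‖x‖ₑ ^ 2 := by
  refine hasSum_norm_sq_iff_tsum_enorm_sq.1 ?_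
  simpa using lp.hasSum_norm (by norm_num) x

theorem exists_fiber_ae_eq {v : ℝ → L2Zn n}
    (hv : ∀ j k, AEMeasurable (fun ξ => v ξ j k) circleMeasure)
    (hfin : ∫⁻ ξ, ‖v ξ‖ₑ ^ 2 ∂circleMeasure ≠ ∞) :
    ∃ φ : L2n n, ∀ᵐ ξ ∂circleMeasure, fiber θ φ ξ = v ξ := by
  choose F hFmeas hF using fun j =>
    exists_measurable_add_mul_eq Real.two_pi_pos fun k => (hv j k).measurable_mk
  have hFv : ∀ᵐ ξ ∂circleMeasure, ∀ j, ∀ k : ℤ, F j (ξ + k * (2 * Real.pi)) = v ξ j k := by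
    filter_upwards [ae_all_iff.2 fun j => ae_all_iff.2 fun k => (hv j k).ae_eq_mk,
      ae_restrict_mem measurableSet_Ioc] with ξ hξ hmem j k
    rw [hF j ξ hmem, hξ]
  have hFmem (j : Fin n) : MemLp (F j) 2 := by
    refine memLp_two_of_lintegral_enorm_sq (hFmeas j).aestronglyMeasurable ?_
    rw [lintegral_eq_lintegral_tsum Real.two_pi_pos ((hFmeas j).enorm.pow_const 2).aemeasurable]
    refine (lintegral_mono_ae ?_).trans_lt hfin.lt_top
    filter_upwards [hFv] with ξ hξ
    simp only [hξ, tsum_enorm_apply_sq]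
    gcongr
    exact PiLp.enorm_apply_le _ j
  obtain ⟨φ, hφ⟩ := exists_twistedHat_ae_eq θ hFmem
  have hφ' := ae_all_iff.2 fun j => (ae_iff_ae_forall_int Real.two_pi_pos).1 (hφ j)
  refine ⟨φ, ?_⟩
  filter_upwards [fiber_apply_ae θ φ, hFv, hφ'] with ξ hfiber hFξ hφξ
  ext j k
  rw [hfiber, hφξ, hFξ]

theorem fiber₁_add (f : Lp ℂ 2 (volume : Measure ℝ)) (ξ : ℝ) (k : ℤ) :
    fiber₁ f (ξ + 2 * k * Real.pi) = (lam₁ k).symm (fiber₁ f ξ) := by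
  have hhat (m : ℤ) : hat f (ξ + 2 * k * Real.pi + 2 * m * Real.pi) =
      hat f (ξ + 2 * ((m - -k : ℤ) : ℝ) * Real.pi) := by
    congr 1
    push_cast
    ring
  have hhat' (m : ℤ) : hat f (ξ + 2 * m * Real.pi) =
      hat f (ξ + 2 * k * Real.pi + 2 * ((m - k : ℤ) : ℝ) * Real.pi) := by
    congr 1
    push_cast
    ring
  by_cases hξ : Memℓp (fun m : ℤ => hat f (ξ + 2 * m * Real.pi)) 2
  · have hξk : Memℓp (fun m : ℤ => hat f (ξ + 2 * k * Real.pi + 2 * m * Real.pi)) 2 := by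
      simp only [hhat]
      exact memℓp_shift (-k) ⟨_, hξ⟩
    rw [fiber₁, fiber₁, dif_pos hξ, dif_pos hξk]
    ext m
    exact hhat m
  · have hξk : ¬ Memℓp (fun m : ℤ => hat f (ξ + 2 * k * Real.pi + 2 * m * Real.pi)) 2 := by
      refine fun hξk => hξ ?_
      simp only [hhat']
      exact memℓp_shift k ⟨_, hξk⟩
    rw [fiber₁, fiber₁, dif_neg hξ, dif_neg hξk, map_zero]

theorem fiber_add (φ : L2n n) (ξ : ℝ) (k : ℤ) :
    fiber θ φ (ξ + 2 * k * Real.pi) = (lam k).symm (fiber θ φ ξ) := by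
  ext j : 1
  change fiber₁ (φ j) (ξ + 2 * k * Real.pi - θ j) = (lam₁ k).symm (fiber₁ (φ j) (ξ - θ j))
  rw [add_sub_right_comm, fiber₁_add]

end Fiberization

section RangeFunction

theorem separableSpace_of_hilbertBasis {H κ : Type*} [NormedAddCommGroup H]
    [InnerProductSpace ℂ H] [Countable κ] (b : HilbertBasis κ ℂ H) :
    TopologicalSpace.SeparableSpace H := by
  have hspan := ((Set.countable_range b).isSeparable.span (R := ℂ)).closure
  rw [← Submodule.topologicalClosure_coe, b.dense_span, Submodule.top_coe] at hspan
  exact TopologicalSpace.isSeparable_univ_iff.1 hspan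

instance : TopologicalSpace.SeparableSpace L2Z := separableSpace_of_hilbertBasis (stdBasis ℤ)

variable {n : ℕ}

instance : TopologicalSpace.SeparableSpace (L2n n) :=
  have : Fact ((2 : ℝ≥0∞) ≠ ∞) := ⟨ENNReal.ofNat_ne_top⟩
  inferInstance

theorem exists_inner_eq_apply (j : Fin n) (k : ℤ) : ∃ e : L2Zn n, ∀ x, ⟪e, x⟫_ℂ = x j k := by
  refine ⟨PiLp.single 2 j (lp.single 2 k 1), fun x => ?_⟩
  rw [PiLp.inner_apply, Finset.sum_eq_single j (fun i _ hi => by simp [hi]) (by simp)]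
  simp [lp.inner_single_left]

theorem aemeasurable_inner_fiber (θ : Fin n → ℝ) (φ : L2n n) (a : L2Zn n) :
    AEMeasurable (fun ξ => ⟪fiber θ φ ξ, a⟫_ℂ) circleMeasure := by
  obtain ⟨ψ, hψ⟩ := exists_fiber_ae_eq θ (v := fun _ => a) (fun _ _ => aemeasurable_const)
    (by rw [lintegral_const]; finiteness)
  refine (integrable_inner_fiber θ φ ψ).1.aemeasurable.congr ?_
  filter_upwards [hψ] with ξ hξ
  rw [hξ]

variable {J : ℝ → ClosedSubmodule ℂ (L2Zn n)}

theorem IsPeriodicRangeFunction.lam_symm_mem (hJ : IsPeriodicRangeFunction J) {ξ : ℝ}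
    {x : L2Zn n} (hx : x ∈ J ξ) (k : ℤ) : (lam k).symm x ∈ J (ξ + 2 * k * Real.pi) := by
  rw [← SetLike.mem_coe, hJ.periodic k ξ]
  exact Set.mem_image_of_mem _ hx

theorem IsPeriodicRangeFunction.aemeasurable_norm_proj_sq (hJ : IsPeriodicRangeFunction J)
    (a : L2Zn n) : AEMeasurable (fun ξ => ‖proj (J ξ) a‖ₑ ^ 2) := by
  have hre (ξ : ℝ) : ‖proj (J ξ) a‖ₑ ^ 2 = ENNReal.ofReal (RCLike.re ⟪proj (J ξ) a, a⟫_ℂ) := by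
    rw [← inner_proj_of_mem (proj_mem a), inner_self_eq_norm_sq, ofReal_norm_sq]
  simp only [hre]
  exact (RCLike.measurable_re.comp_aemeasurable (hJ.measurable a a)).ennreal_ofReal

theorem IsPeriodicRangeFunction.aemeasurable_proj_apply (hJ : IsPeriodicRangeFunction J)
    (a : L2Zn n) (j : Fin n) (k : ℤ) : AEMeasurable (fun ξ => proj (J ξ) a j k) := by
  obtain ⟨e, he⟩ := exists_inner_eq_apply j k
  simp only [← he, ← inner_conj_symm e]
  exact Complex.continuous_conj.measurable.comp_aemeasurable (hJ.measurable a e)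

variable {θ : Fin n → ℝ} {V : ClosedSubmodule ℂ (L2n n)} {Φ : Set (L2n n)}

theorem IsRangeFunctionOf.exists_mem_fiber_ae_eq (hJ : IsRangeFunctionOf θ V J)
    {v : ℝ → L2Zn n} (hv : ∀ j k, AEMeasurable (fun ξ => v ξ j k) circleMeasure)
    (hfin : ∫⁻ ξ, ‖v ξ‖ₑ ^ 2 ∂circleMeasure ≠ ∞) (hmem : ∀ ξ, v ξ ∈ J ξ) :
    ∃ f ∈ V, ∀ᵐ ξ ∂circleMeasure, fiber θ f ξ = v ξ := by
  obtain ⟨f, hf⟩ := exists_fiber_ae_eq θ hv hfin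
  refine ⟨f, (hJ.mem_iff f).2 ((ae_iff_ae_forall_int Real.two_pi_pos).2 ?_), hf⟩
  filter_upwards [hf] with ξ hξ k
  rw [mul_left_comm, ← mul_assoc, fiber_add, hξ]
  exact hJ.lam_symm_mem (hmem ξ) k

theorem IsRangeFunctionOf.exists_mem_fiber_ae_eq_indicator (hJ : IsRangeFunctionOf θ V J)
    (a : L2Zn n) {E : Set ℝ} (hE : MeasurableSet E) :
    ∃ f ∈ V, ∀ᵐ ξ ∂circleMeasure, fiber θ f ξ = E.indicator (fun ξ => proj (J ξ) a) ξ := by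
  have hnorm (ξ : ℝ) : ‖E.indicator (fun ξ => proj (J ξ) a) ξ‖ₑ ≤ ‖a‖ₑ :=
    (enorm_indicator_le_enorm_self _ ξ).trans (enorm_le_iff_norm_le.2 (norm_proj_apply_le a))
  refine hJ.exists_mem_fiber_ae_eq (fun j k => ?_) (ne_of_lt ?_) fun ξ => ?_
  · refine ((hJ.aemeasurable_proj_apply a j k).restrict.indicator hE).congr
      (ae_of_all _ fun ξ => ?_)
    by_cases hξ : ξ ∈ E <;> simp [hξ]
  · calc ∫⁻ ξ, ‖E.indicator (fun ξ => proj (J ξ) a) ξ‖ₑ ^ 2 ∂circleMeasure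
        ≤ ∫⁻ _, ‖a‖ₑ ^ 2 ∂circleMeasure := by gcongr; exact hnorm _
      _ < ∞ := by rw [lintegral_const]; finiteness
  · by_cases hξ : ξ ∈ E
    · simpa only [Set.indicator_of_mem hξ] using proj_mem a
    · simp only [Set.indicator_of_notMem hξ, zero_mem]

theorem IsNTFGenerator.countable (hΦ : IsNTFGenerator θ V Φ) : Φ.Countable := by
  have hnonzero : (Φ \ {0}).Countable := by
    refine (hΦ.2.isBessel.countable_ne_zero.image fun p => (p.2 : L2n n)).mono fun φ hφ => ?_
    exact ⟨(0, ⟨φ, hφ.1⟩), by simpa [shift_zero] using hφ.2, rfl⟩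
  exact (hnonzero.insert 0).mono (by simp)

theorem IsNTFGenerator.tsum_lintegral_enorm_inner_fiber_sq (hΦ : IsNTFGenerator θ V Φ)
    {f : L2n n} (hf : f ∈ V) {C : ℝ} (hC : ∀ᵐ ξ ∂circleMeasure, ‖fiber θ f ξ‖ ≤ C) :
    ∑' φ : Φ, ∫⁻ ξ, ‖⟪fiber θ f ξ, fiber θ φ ξ⟫_ℂ‖ₑ ^ 2 ∂circleMeasure =
      ∫⁻ ξ, ‖fiber θ f ξ‖ₑ ^ 2 ∂circleMeasure := by
  simp only [← ofReal_mul_tsum_enorm_inner_shift_sq θ f _ hC, ENNReal.tsum_mul_left,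
    lintegral_enorm_fiber_sq]
  rw [ENNReal.tsum_comm, ← ENNReal.tsum_prod, hasSum_norm_sq_iff_tsum_enorm_sq.1 (hΦ.2.2 f hf)]

theorem IsNTFGenerator.ae_circle_mem (hJ : IsRangeFunctionOf θ V J) (hΦ : IsNTFGenerator θ V Φ) :
    ∀ᵐ ξ ∂circleMeasure, ∀ φ : Φ, fiber θ φ ξ ∈ J ξ :=
  have : Countable Φ := hΦ.countable.to_subtype
  ae_all_iff.2 fun φ => ae_restrict_of_ae ((hJ.mem_iff φ).1 (hΦ.1 φ φ.2))

/-- Testing the Parseval identity against the elements of `V` whose fiber is `1_E proj (J ξ) a`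
localizes it to `E`. -/
theorem IsNTFGenerator.setLIntegral_tsum_eq (hJ : IsRangeFunctionOf θ V J)
    (hΦ : IsNTFGenerator θ V Φ) (a : L2Zn n) {E : Set ℝ} (hE : MeasurableSet E) :
    ∫⁻ ξ in E, ∑' φ : Φ, ‖⟪fiber θ φ ξ, a⟫_ℂ‖ₑ ^ 2 ∂circleMeasure =
      ∫⁻ ξ in E, ‖proj (J ξ) a‖ₑ ^ 2 ∂circleMeasure := by
  have : Countable Φ := hΦ.countable.to_subtype
  obtain ⟨f, hfV, hf⟩ := hJ.exists_mem_fiber_ae_eq_indicator a hE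
  have hbound : ∀ᵐ ξ ∂circleMeasure, ‖fiber θ f ξ‖ ≤ ‖a‖ := by
    filter_upwards [hf] with ξ hξ
    rw [hξ]
    exact (norm_indicator_le_norm_self _ ξ).trans (norm_proj_apply_le a)
  have hparseval := hΦ.tsum_lintegral_enorm_inner_fiber_sq hfV hbound
  rw [← lintegral_tsum fun φ : Φ => (integrable_inner_fiber θ f φ).1.enorm.pow_const 2]
    at hparseval
  rw [← lintegral_indicator hE, ← lintegral_indicator hE]
  refine Eq.trans (lintegral_congr_ae ?_) (hparseval.trans (lintegral_congr_ae ?_))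
  · filter_upwards [hf, hΦ.ae_circle_mem hJ] with ξ hξ hmem
    by_cases hξE : ξ ∈ E
    · simp only [hξ, Set.indicator_of_mem hξE, enorm_inner_symm (proj (J ξ) a),
        fun φ : Φ => inner_proj_of_mem (hmem φ) a]
    · simp [hξ, hξE]
  · filter_upwards [hf] with ξ hξ
    by_cases hξE : ξ ∈ E <;> simp [hξ, hξE]

theorem IsNTFGenerator.ae_circle_hasSum (hJ : IsRangeFunctionOf θ V J)
    (hΦ : IsNTFGenerator θ V Φ) (a : L2Zn n) : ∀ᵐ ξ ∂circleMeasure,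
      HasSum (fun φ : Φ => ‖⟪fiber θ φ ξ, a⟫_ℂ‖ ^ 2) (‖proj (J ξ) a‖ ^ 2) := by
  have : Countable Φ := hΦ.countable.to_subtype
  have hmeas : AEMeasurable (fun ξ => ∑' φ : Φ, ‖⟪fiber θ φ ξ, a⟫_ℂ‖ₑ ^ 2) circleMeasure :=
    .tsum fun φ => (aemeasurable_inner_fiber θ φ a).enorm.pow_const 2
  filter_upwards [ae_eq_of_forall_setLIntegral_eq_of_sigmaFinite₀ hmeas
    (hJ.aemeasurable_norm_proj_sq a).restrict
    fun E hE _ => hΦ.setLIntegral_tsum_eq hJ a hE] with ξ hξ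
  exact hasSum_norm_sq_iff_tsum_enorm_sq.2 hξ

theorem IsNTFGenerator.ae_circle_isNTF_fiber (hJ : IsRangeFunctionOf θ V J)
    (hΦ : IsNTFGenerator θ V Φ) :
    ∀ᵐ ξ ∂circleMeasure, IsNTF (J ξ) (fun φ : Φ => fiber θ φ ξ) := by
  obtain ⟨D, hDcount, hD⟩ := TopologicalSpace.exists_countable_dense (L2Zn n)
  filter_upwards [hΦ.ae_circle_mem hJ, (ae_ball_iff hDcount).2 fun a _ => hΦ.ae_circle_hasSum hJ a]
    with ξ hmem hsum
  exact .of_dense hD hmem hsum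

theorem IsNTFGenerator.ae_isNTF_fiber (hJ : IsRangeFunctionOf θ V J)
    (hΦ : IsNTFGenerator θ V Φ) : ∀ᵐ ξ, IsNTF (J ξ) (fun φ : Φ => fiber θ φ ξ) := by
  refine (ae_iff_ae_forall_int Real.two_pi_pos).2 ?_
  filter_upwards [hΦ.ae_circle_isNTF_fiber hJ] with ξ hξ k
  rw [mul_left_comm, ← mul_assoc]
  simpa only [fiber_add] using hξ.map_unitary (lam k).symm (hJ.periodic k ξ)

theorem IsNTFGenerator.ae_localTracePos_eq (hJ : IsRangeFunctionOf θ V J)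
    (hΦ : IsNTFGenerator θ V Φ) {T : L2Zn n →L[ℂ] L2Zn n} (hT : T.IsPositive) :
    ∀ᵐ ξ : ℝ, localTracePos J T ξ =
      ∑' φ : Φ, ENNReal.ofReal (RCLike.re ⟪fiber θ φ ξ, T (fiber θ φ ξ)⟫_ℂ) :=
  (hΦ.ae_isNTF_fiber hJ).mono fun _ hξ => hξ.posTrace_proj_comp hT

theorem IsNTFGenerator.ae_hasSum_localTrace (hJ : IsRangeFunctionOf θ V J)
    (hΦ : IsNTFGenerator θ V Φ) {T : L2Zn n →L[ℂ] L2Zn n} (hT : IsTraceClass T) :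
    ∀ᵐ ξ : ℝ, HasSum (fun φ : Φ => ⟪fiber θ φ ξ, T (fiber θ φ ξ)⟫_ℂ) (localTrace J T ξ) :=
  (hΦ.ae_isNTF_fiber hJ).mono fun _ hξ => hξ.hasSum_trace_comp_proj hT

theorem IsNTFGenerator.ae_localTracePos_rankOneOp_eq (hJ : IsRangeFunctionOf θ V J)
    (hΦ : IsNTFGenerator θ V Φ) (f : L2Zn n) :
    ∀ᵐ ξ : ℝ, localTracePos J (rankOneOp f) ξ =
      ∑' φ : Φ, ENNReal.ofReal (‖⟪fiber θ φ ξ, f⟫_ℂ‖ ^ 2) := by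
  simpa only [inner_rankOneOp] using! hΦ.ae_localTracePos_eq hJ (isPositive_rankOneOp f)

theorem IsNTFGenerator.ae_hasSum_localTrace_rankOneOp (hJ : IsRangeFunctionOf θ V J)
    (hΦ : IsNTFGenerator θ V Φ) (f : L2Zn n) :
    ∀ᵐ ξ : ℝ, HasSum (fun φ : Φ => ((‖⟪fiber θ φ ξ, f⟫_ℂ‖ ^ 2 : ℝ) : ℂ))
      (localTrace J (rankOneOp f) ξ) := by
  simpa only [inner_rankOneOp] using! hΦ.ae_hasSum_localTrace hJ (isTraceClass_rankOneOp f)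

end RangeFunction

end LocalTrace

end

theorem mainTheorem1 {n : ℕ} (θ : Fin n → ℝ)
    (V : ClosedSubmodule ℂ (L2n n)) (hV : IsShiftInvariant θ V)
    (J : ℝ → ClosedSubmodule ℂ (L2Zn n)) (hJ : IsRangeFunctionOf θ V J)
    (Φ : Set (L2n n)) (hΦ : IsNTFGenerator θ V Φ) :
    -- positive operators: equality in `[0, ∞]`
    (∀ T : L2Zn n →L[ℂ] L2Zn n, T.IsPositive → ∀ᵐ ξ : ℝ,
      localTracePos J T ξ =
        ∑' φ : Φ, ENNReal.ofReal (RCLike.re (inner ℂ (fiber θ φ ξ) (T (fiber θ φ ξ))))) ∧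
    -- trace-class operators: the trace exists and the (absolutely convergent) sum equals it
    (∀ T : L2Zn n →L[ℂ] L2Zn n, IsTraceClass T → ∀ᵐ ξ : ℝ,
      IsTraceClass (T ∘L proj (J ξ)) ∧
      HasSum (fun φ : Φ => inner ℂ (fiber θ φ ξ) (T (fiber θ φ ξ))) (localTrace J T ξ)) ∧
    -- rank-one operators `P_f`, with both readings of the trace
    (∀ f : L2Zn n, ∀ᵐ ξ : ℝ,
      localTracePos J (rankOneOp f) ξ =
        ∑' φ : Φ, ENNReal.ofReal (‖inner ℂ (fiber θ φ ξ) f‖ ^ 2) ∧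
      HasSum (fun φ : Φ => ((‖inner ℂ (fiber θ φ ξ) f‖ ^ 2 : ℝ) : ℂ))
        (localTrace J (rankOneOp f) ξ)) ∧
    -- independence of the generator
    (∀ Ψ : Set (L2n n), IsNTFGenerator θ V Ψ →
      (∀ T : L2Zn n →L[ℂ] L2Zn n, T.IsPositive → ∀ᵐ ξ : ℝ,
        ∑' φ : Φ, ENNReal.ofReal (RCLike.re (inner ℂ (fiber θ φ ξ) (T (fiber θ φ ξ)))) =
          ∑' ψ : Ψ, ENNReal.ofReal (RCLike.re (inner ℂ (fiber θ ψ ξ) (T (fiber θ ψ ξ))))) ∧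
      (∀ T : L2Zn n →L[ℂ] L2Zn n, IsTraceClass T → ∀ᵐ ξ : ℝ,
        ∑' φ : Φ, inner ℂ (fiber θ φ ξ) (T (fiber θ φ ξ)) =
          ∑' ψ : Ψ, inner ℂ (fiber θ ψ ξ) (T (fiber θ ψ ξ))) ∧
      (∀ f : L2Zn n, ∀ᵐ ξ : ℝ,
        ∑' φ : Φ, ENNReal.ofReal (‖inner ℂ (fiber θ φ ξ) f‖ ^ 2) =
          ∑' ψ : Ψ, ENNReal.ofReal (‖inner ℂ (fiber θ ψ ξ) f‖ ^ 2))) := by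
  refine ⟨fun T hT => hΦ.ae_localTracePos_eq hJ hT, fun T hT => ?_, fun f => ?_,
    fun Ψ hΨ => ⟨fun T hT => ?_, fun T hT => ?_, fun f => ?_⟩⟩
  · filter_upwards [hΦ.ae_hasSum_localTrace hJ hT] with ξ hsum
    exact ⟨hT.comp_right _, hsum⟩
  · exact (hΦ.ae_localTracePos_rankOneOp_eq hJ f).and (hΦ.ae_hasSum_localTrace_rankOneOp hJ f)
  · filter_upwards [hΦ.ae_localTracePos_eq hJ hT, hΨ.ae_localTracePos_eq hJ hT] with ξ hξΦ hξΨ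
    exact hξΦ.symm.trans hξΨ
  · filter_upwards [hΦ.ae_hasSum_localTrace hJ hT, hΨ.ae_hasSum_localTrace hJ hT] with ξ hξΦ hξΨ
    exact hξΦ.tsum_eq.trans hξΨ.tsum_eq.symm
  · filter_upwards [hΦ.ae_localTracePos_rankOneOp_eq hJ f,
      hΨ.ae_localTracePos_rankOneOp_eq hJ f] with ξ hξΦ hξΨ
    exact hξΦ.symm.trans hξΨ
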